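/- Fix a point $r\in\mathbb R^2$ (the root), points $t_1,\dots,t_n\in\mathbb R^2$ (the terminals) and a restricting angle $0\le\alpha<\pi/2$. A *Steiner arborescence* $T$ for this input has a finite set of nodes in the plane containing $r$ and all terminals (the other nodes are Steiner nodes); every node $v\ne r$ has exactly one outgoing arc, a curve from $v$ to another node, and following the arcs from any node one arrives at $r$. Its length $L(T)$ is the sum of the lengths of its arcs. $T$ is a *flux tree* if its arcs are rectifiable (parametrised as Lipschitz curves) and at almost every point $p$ of every arc the angle between the tangent vector of the arc, directed towards the root, and the vector $r-p$ is at most $\alpha$. In polar coordinates centred at $r$, the right and the left spiral of a point $p=(R,\varphi)\neq r$ are the logarithmic spirals $u\mapsto(Re^{-u},\ \varphi\pm u\tan\alpha)$, $u\ge 0$. A *spiral tree* is a flux tree each of whose arcs is a concatenation of finitely many spiral segments, where each segment follows the right or the left spiral of its initial point, either up to a finite parameter $u$ or all the way to $r$ (the limit $u\to\infty$). An *optimal* flux tree (spiral tree) is a flux tree (spiral tree) of minimum length for the given root, terminals and $\alpha$. Then every optimal spiral tree $T'$ and every optimal flux tree $T$ satisfy $$L(T')\le\sec(\alpha)\,L(T).$$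 More generally, whether or not the minima are attained, $$\inf\{L(T'):T'\text{ a spiral tree}\}\ \le\ \sec(\alpha)\,\inf\{L(T):T\text{ a flux tree}\}.$$ -/

import Mathlib

open Set MeasureTheory

/-- A *Steiner arborescence* in the Euclidean plane (identified with `ℂ`) for the root `r` and the
terminals `t i`. Its nodes form a finite set of points that contains the root and every terminal;
the remaining nodes are Steiner nodes. Arcs are directed towards the root: every node `v ≠ r` has
exactly one outgoing arc, the curve `arc v` on `[0, 1]` from `v` to the node `parent v`, and every
node is connected to the root by following the arcs. (The values of `parent` and `arc` at `r` and
away from the nodes, and those of `arc v` outside `[0, 1]`, play no role.) -/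
structure SteinerArborescence (r : ℂ) {n : ℕ} (t : Fin n → ℂ) where
  nodes : Finset ℂ
  root_mem : r ∈ nodes
  terminal_mem : ∀ i, t i ∈ nodes
  parent : ℂ → ℂ
  parent_mem : ∀ v ∈ nodes, v ≠ r → parent v ∈ nodes
  reaches_root : ∀ v ∈ nodes, ∃ k : ℕ, parent^[k] v = r
  arc : ℂ → ℝ → ℂ
  arc_continuousOn : ∀ v ∈ nodes, v ≠ r → ContinuousOn (arc v) (Icc 0 1)
  arc_zero : ∀ v ∈ nodes, v ≠ r → arc v 0 = v
  arc_one : ∀ v ∈ nodes, v ≠ r → arc v 1 = parent v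

/-- The length of an arborescence: the sum of the lengths of its arcs, the length of a curve being
its total variation (the supremum of the lengths of inscribed polygons). -/
noncomputable def SteinerArborescence.length {r : ℂ} {n : ℕ} {t : Fin n → ℂ}
    (T : SteinerArborescence r t) : ENNReal :=
  ∑ v ∈ T.nodes.erase r, eVariationOn (T.arc v) (Icc 0 1)

/-- The curve `c` on `[0, 1]` is *angle-restricted* with restricting angle `α`: it is a Lipschitz
curve, and at almost every parameter it has a tangent vector `w` which forms an angle of at most `α`
with the vector from the point of the curve to the root `r`. (As `angle x 0 = angle 0 x = π / 2`,
the tangent vector is not zero and the point is not the root, if `α < π / 2`.) -/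
def IsAngleRestricted (r : ℂ) (α : ℝ) (c : ℝ → ℂ) : Prop :=
  (∃ K : NNReal, LipschitzOnWith K c (Icc 0 1)) ∧
    ∀ᵐ s : ℝ, s ∈ Ioo (0 : ℝ) 1 →
      ∃ w : ℂ, HasDerivAt c w s ∧ InnerProductGeometry.angle (r - c s) w ≤ α

/-- The logarithmic spirals through `p` around `r`. In polar coordinates with centre `r`, if
`p = (R, φ)`, the point at parameter `u` is `(R e ^ (-u), φ + σ tan α u)`: for `σ = 1` this is the
right spiral of `p`, for `σ = -1` the left spiral of `p`. -/
noncomputable def logSpiral (r : ℂ) (α σ : ℝ) (p : ℂ) (u : ℝ) : ℂ :=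
  r + (p - r) * Complex.exp ((-u : ℝ) + (σ * Real.tan α * u : ℝ) * Complex.I)

/-- The curve `c` on `[a, b]` runs along a *spiral segment* towards `r`: up to the change of
parameter `τ` it follows the right spiral or the left spiral of its initial point. If `τ` is
unbounded then, by continuity, the segment is the whole spiral and ends at `c b = r`. -/
def IsSpiralSegment (r : ℂ) (α : ℝ) (c : ℝ → ℂ) (a b : ℝ) : Prop :=
  a < b ∧ c a ≠ r ∧ ContinuousOn c (Icc a b) ∧
    ∃ σ : ℝ, (σ = 1 ∨ σ = -1) ∧
      ∃ τ : ℝ → ℝ, τ a = 0 ∧ StrictMonoOn τ (Ico a b) ∧ ContinuousOn τ (Ico a b) ∧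
        ∀ s ∈ Ico a b, c s = logSpiral r α σ (c a) (τ s)

/-- The curve `c` on `[0, 1]` consists of finitely many consecutive spiral segments. -/
def IsPiecewiseSpiral (r : ℂ) (α : ℝ) (c : ℝ → ℂ) : Prop :=
  ∃ (m : ℕ) (x : ℕ → ℝ), x 0 = 0 ∧ x m = 1 ∧
    ∀ i < m, IsSpiralSegment r α c (x i) (x (i + 1))

namespace SteinerArborescence

variable {r : ℂ} {n : ℕ} {t : Fin n → ℂ}

/-- A *flux tree*: a Steiner arborescence all of whose arcs obey the angle restriction. -/
def IsFluxTree (α : ℝ) (T : SteinerArborescence r t) : Prop :=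
  ∀ v ∈ T.nodes, v ≠ r → IsAngleRestricted r α (T.arc v)

/-- A *spiral tree*: a flux tree whose arcs consist only of spiral segments. -/
def IsSpiralTree (α : ℝ) (T : SteinerArborescence r t) : Prop :=
  T.IsFluxTree α ∧ ∀ v ∈ T.nodes, v ≠ r → IsPiecewiseSpiral r α (T.arc v)

/-- A shortest flux tree. -/
def IsOptimalFluxTree (α : ℝ) (T : SteinerArborescence r t) : Prop :=
  T.IsFluxTree α ∧ ∀ S : SteinerArborescence r t, S.IsFluxTree α → T.length ≤ S.length

/-- A shortest spiral tree. -/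
def IsOptimalSpiralTree (α : ℝ) (T : SteinerArborescence r t) : Prop :=
  T.IsSpiralTree α ∧ ∀ S : SteinerArborescence r t, S.IsSpiralTree α → T.length ≤ S.length

end SteinerArborescence

/-!
Every flux tree can be turned into a spiral tree with the same nodes, arc by arc, so that no arc
becomes longer by more than the factor `sec α`. Both claims follow at once.

In logarithmic polar coordinates `log (z - r)` around the root, the angle restriction says that the
velocity `c' / (c - r)` lies in the sector of half-angle `α` around the negative real axis. Hence so
does the total displacement `w` along an arc that ends away from the root
(`IsAngleRestricted.exists_exp`); there the logarithm is the integral of `c' / (c - r)`, which is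
legitimate because the arc stays away from the root (`IsAngleRestricted.norm_sub_one_le`). The right
and the left spiral run along the two boundary rays of that sector, so `w` is the sum of a
displacement along the right spiral and one along the left spiral, and these two spiral segments
join the end points of the arc. If the arc ends at the root, a whole spiral joins its end points.

A spiral moves at the constant angle `α` to the direction of the root, so the length of the
replacement is `sec α` times the decrease of the distance to the root
(`lipschitzOnWith_spiralCurve`), while the length of the original arc is at least this decrease
(`IsAngleRestricted.exists_spiral_arc`).
-/

/-! ### Angle-restricted curves in logarithmic polar coordinates -/

/-- A tangent vector `w` at the point `z` that forms an angle of at most `α` with the direction `-z`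
towards the origin has logarithmic derivative `w / z` in the sector of half-angle `α` around the
negative real axis. -/
lemma re_div_nonpos_and_abs_im_div_le_of_angle_le {z w : ℂ} {α : ℝ} (hα₀ : 0 ≤ α)
    (hα : α < Real.pi / 2) (h : InnerProductGeometry.angle (-z) w ≤ α) :
    (w / z).re ≤ 0 ∧ |(w / z).im| ≤ Real.tan α * -(w / z).re := by
  have hcos : 0 < Real.cos α := Real.cos_pos_of_mem_Ioo ⟨by linarith [Real.pi_pos], hα⟩
  have hz : z ≠ 0 := by
    rintro rfl
    rw [neg_zero, InnerProductGeometry.angle_zero_left] at h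
    linarith
  have hw : w ≠ 0 := by
    rintro rfl
    rw [InnerProductGeometry.angle_zero_right] at h
    linarith
  have harg : |(-(w / z)).arg| ≤ α := by
    rw [← InnerProductGeometry.angle_neg_neg, neg_neg,
      Complex.angle_eq_abs_arg hz (neg_ne_zero.2 hw)] at h
    rw [← Complex.abs_arg_inv]
    convert h using 3
    field_simp
  set u := -(w / z) with hu
  have hu0 : u ≠ 0 := neg_ne_zero.2 (div_ne_zero hw hz)
  have hre : (w / z).re = -u.re := by simp [hu]
  have him : (w / z).im = -u.im := by simp [hu]
  rw [hre, him, abs_neg, neg_neg]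
  have hlt : |u.arg| < Real.pi / 2 := harg.trans_lt hα
  have hpos : 0 < u.re := by
    rcases Complex.abs_arg_lt_pi_div_two_iff.1 hlt with h | h
    · exact h
    · exact absurd h hu0
  refine ⟨by linarith, ?_⟩
  have htan : u.im = Real.tan u.arg * u.re := by
    rw [Complex.tan_arg]; field_simp
  rw [htan, abs_mul, abs_of_pos hpos]
  refine mul_le_mul_of_nonneg_right ?_ hpos.le
  obtain ⟨h1, h2⟩ := abs_le.1 harg
  have hm : ∀ x y : ℝ, -α ≤ x → x ≤ y → y ≤ α → Real.tan x ≤ Real.tan y := fun x y hx hxy hy =>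
    (Real.strictMonoOn_tan.le_iff_le ⟨by linarith, by linarith⟩ ⟨by linarith, by linarith⟩).2 hxy
  rw [abs_le]
  refine ⟨?_, hm _ _ h1 h2 le_rfl⟩
  rw [← Real.tan_neg]
  exact hm _ _ le_rfl h1 h2

/-- The squared distance to the root is absolutely continuous and its derivative
`2 ⟪c - r, c'⟫` is almost everywhere nonpositive, so an angle-restricted curve is closest to the
root at its end point. In particular, it avoids the root if its end point does. -/
lemma IsAngleRestricted.norm_sub_one_le {r : ℂ} {α : ℝ} {c : ℝ → ℂ} (hα₀ : 0 ≤ α)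
    (hα : α < Real.pi / 2) (hc : IsAngleRestricted r α c) {s : ℝ} (hs : s ∈ Icc (0 : ℝ) 1) :
    ‖c 1 - r‖ ≤ ‖c s - r‖ := by
  obtain ⟨⟨K, hK⟩, hang⟩ := hc
  have hKs : LipschitzOnWith K (fun x => ‖c x - r‖) (uIcc s 1) := by
    rw [uIcc_of_le hs.2]
    refine LipschitzOnWith.of_dist_le_mul fun x hx y hy => ?_
    refine le_trans ?_ (hK.dist_le_mul x ⟨hs.1.trans hx.1, hx.2⟩ y ⟨hs.1.trans hy.1, hy.2⟩)
    rw [Real.dist_eq, dist_eq_norm]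
    refine (abs_norm_sub_norm_le _ _).trans (by simp)
  have hac := hKs.absolutelyContinuousOnInterval
  have hint := (hac.fun_mul hac).integral_deriv_eq_sub
  have hle : ∫ x in s..1, deriv (fun x => ‖c x - r‖ * ‖c x - r‖) x ≤ 0 := by
    rw [intervalIntegral.integral_of_le hs.2]
    refine setIntegral_nonpos_of_ae_restrict ?_
    have h1 : ∀ᵐ x : ℝ, x ≠ 1 := by simp [ae_iff, measure_singleton]
    refine (ae_restrict_iff' measurableSet_Ioc).2 ?_
    filter_upwards [hang, h1] with x hx hx1 hxs
    obtain ⟨w, hw, hwa⟩ := hx ⟨hs.1.trans_lt hxs.1, lt_of_le_of_ne hxs.2 hx1⟩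
    have hd := (hw.sub_const r).norm_sq
    have heq : (fun x => ‖c x - r‖ * ‖c x - r‖) = fun x => ‖c x - r‖ ^ 2 := by
      funext y; ring
    rw [heq, hd.deriv]
    have hin : 0 ≤ inner ℝ (r - c x) w := by
      rw [← InnerProductGeometry.cos_angle_mul_norm_mul_norm]
      have := InnerProductGeometry.angle_nonneg (r - c x) w
      have := Real.cos_nonneg_of_mem_Icc (x := InnerProductGeometry.angle (r - c x) w)
        ⟨by linarith [Real.pi_pos], by linarith⟩
      positivity
    have : inner ℝ (c x - r) w = - inner ℝ (r - c x) w := by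
      rw [← inner_neg_left, neg_sub]
    simp only [Pi.zero_apply]
    linarith
  rw [hint] at hle
  nlinarith [norm_nonneg (c 1 - r), norm_nonneg (c s - r)]

/-- A Lipschitz curve bounded away from `0` has the continuous logarithm `F = ∫ f' / f`, since
`exp (-F) * f` is absolutely continuous with derivative zero almost everywhere. -/
lemma eq_mul_exp_integral_of_lipschitz {f : ℝ → ℂ} {K : NNReal} (hf : LipschitzWith K f)
    {m : ℝ} (hm : 0 < m) (hfm : ∀ s, m ≤ ‖f s‖)
    (hd : ∀ᵐ s : ℝ, s ∈ Ioo (0 : ℝ) 1 → DifferentiableAt ℝ f s) :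
    IntervalIntegrable (fun s => deriv f s / f s) volume 0 1 ∧
      f 1 = f 0 * Complex.exp (∫ s in (0 : ℝ)..1, deriv f s / f s) := by
  have h0 : ∀ s, f s ≠ 0 := fun s => norm_pos_iff.1 (hm.trans_le (hfm s))
  set g : ℝ → ℂ := fun s => deriv f s / f s with hg
  have hgm : Measurable g := (measurable_deriv f).div hf.continuous.measurable
  have hgb : ∀ s, ‖g s‖ ≤ K / m := fun s => by
    rw [hg, norm_div]
    exact div_le_div₀ K.2 (norm_deriv_le_of_lipschitz hf) hm (hfm s)
  have hgi : ∀ a b : ℝ, IntervalIntegrable g volume a b := fun a b =>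
    (intervalIntegrable_const (c := (K / m : ℝ))).mono_fun hgm.aestronglyMeasurable
      (Filter.Eventually.of_forall fun s => (hgb s).trans (le_abs_self _))
  set F : ℝ → ℂ := fun x => ∫ s in (0 : ℝ)..x, g s with hF
  have hFl : LipschitzWith (K / ⟨m, hm.le⟩) F := by
    refine LipschitzWith.of_dist_le_mul fun x y => ?_
    rw [dist_eq_norm, hF, intervalIntegral.integral_interval_sub_left (hgi _ _) (hgi _ _)]
    exact intervalIntegral.norm_integral_le_of_norm_le_const fun s _ => hgb s
  have hEl : ∃ L, LipschitzOnWith L (fun x => Complex.exp (-F x)) (uIcc 0 1) := by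
    obtain ⟨R, hR⟩ := (isCompact_uIcc.image (s := uIcc (0 : ℝ) 1)
      hFl.continuous.neg).isBounded.subset_closedBall 0
    obtain ⟨L, hL⟩ := (Complex.contDiff_exp (𝕜 := ℝ) (n := 1)).contDiffOn.exists_lipschitzOnWith
      (by decide) (convex_closedBall (0 : ℂ) R) (isCompact_closedBall _ _)
    refine ⟨L * _, hL.comp hFl.neg.lipschitzOnWith fun x hx => hR ⟨x, hx, rfl⟩⟩
  obtain ⟨L, hL⟩ := hEl
  have hac := hL.absolutelyContinuousOnInterval.smul
    (hf.lipschitzOnWith (s := uIcc 0 1)).absolutelyContinuousOnInterval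
  have hz : ∀ᵐ x : ℝ, x ∈ uIcc (0 : ℝ) 1 →
      HasDerivAt ((fun x => Complex.exp (-F x)) • f) 0 x := by
    have h1 : ∀ᵐ x : ℝ, x ≠ 1 := by simp [ae_iff, measure_singleton]
    have h0' : ∀ᵐ x : ℝ, x ≠ 0 := by simp [ae_iff, measure_singleton]
    filter_upwards [hd, (hgi 0 1).ae_hasDerivAt_integral, h0', h1] with x hx hFx hx0 hx1 hxs
    have hFx := hFx hxs 0 (by simp)
    rw [uIcc_of_le zero_le_one] at hxs
    have hx := (hx ⟨lt_of_le_of_ne hxs.1 (Ne.symm hx0), lt_of_le_of_ne hxs.2 hx1⟩).hasDerivAt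
    convert! hFx.fun_neg.cexp.mul hx using 1
    have := h0 x
    simp only [hg]
    field_simp
    ring
  obtain ⟨C, hC⟩ := hac.const_of_ae_hasDerivAt_zero hz
  have e0 := hC 0 (by simp)
  have e1 := hC 1 (by simp)
  simp only [Pi.smul_apply', smul_eq_mul] at e0 e1
  have hF0 : F 0 = 0 := by simp [hF]
  rw [hF0] at e0
  have hE : Complex.exp (F 1) * Complex.exp (-F 1) = 1 := by rw [← Complex.exp_add]; simp
  refine ⟨hgi 0 1, ?_⟩
  change f 1 = f 0 * Complex.exp (F 1)
  rw [neg_zero, Complex.exp_zero, one_mul] at e0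
  rw [e0, ← e1]
  linear_combination (-f 1) * hE

/-- In logarithmic polar coordinates around the root, the displacement `w` along an angle-restricted
curve that does not end at the root lies in the sector of half-angle `α` around the negative real
axis. Here `w.im` is the total change of the polar angle along the curve, not reduced modulo `2π`.
The integrand `c' / (c - r)` of `w` lies in this sector almost everywhere. -/
lemma IsAngleRestricted.exists_exp {r : ℂ} {α : ℝ} {c : ℝ → ℂ} (hα₀ : 0 ≤ α)
    (hα : α < Real.pi / 2) (hc : IsAngleRestricted r α c) (h1 : c 1 ≠ r) :
    ∃ w : ℂ, c 1 - r = (c 0 - r) * Complex.exp w ∧ w.re ≤ 0 ∧ |w.im| ≤ Real.tan α * -w.re := by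
  have hanti := fun s (hs : s ∈ Icc (0 : ℝ) 1) => hc.norm_sub_one_le hα₀ hα hs
  obtain ⟨⟨K, hK⟩, hang⟩ := hc
  have hm : 0 < ‖c 1 - r‖ := norm_pos_iff.2 (sub_ne_zero.2 h1)
  -- Extending `c` by constants beyond `[0, 1]` makes it Lipschitz on the whole line.
  set P : ℝ → ℝ := fun s => projIcc (0 : ℝ) 1 zero_le_one s with hP
  have hPm : ∀ s, P s ∈ Icc (0 : ℝ) 1 := fun s => (projIcc (0 : ℝ) 1 zero_le_one s).2
  have hPe : ∀ s ∈ Icc (0 : ℝ) 1, P s = s := fun s hs => by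
    simp [hP, projIcc_of_mem zero_le_one hs]
  have hPl : LipschitzWith 1 P := (LipschitzWith.projIcc zero_le_one)
  set f : ℝ → ℂ := fun s => c (P s) - r with hf
  have hfl : LipschitzWith K f := LipschitzWith.of_dist_le_mul fun x y => by
    rw [hf, dist_sub_right]
    refine (hK.dist_le_mul _ (hPm x) _ (hPm y)).trans ?_
    have := hPl.dist_le_mul x y
    rw [NNReal.coe_one, one_mul] at this
    gcongr
  have hfd : ∀ s ∈ Ioo (0 : ℝ) 1, ∀ w, HasDerivAt c w s → HasDerivAt f w s := fun s hs w hw => by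
    refine (hw.sub_const r).congr_of_eventuallyEq ?_
    filter_upwards [Ioo_mem_nhds hs.1 hs.2] with x hx
    simp only [hf, hPe x (Ioo_subset_Icc_self hx)]
  have hfe : ∀ s ∈ Icc (0 : ℝ) 1, f s = c s - r := fun s hs => by simp only [hf, hPe s hs]
  have hfm : ∀ s, ‖c 1 - r‖ ≤ ‖f s‖ := fun s => hanti _ (hPm s)
  obtain ⟨hgi, hexp⟩ := eq_mul_exp_integral_of_lipschitz hfl hm hfm
    (hang.mono fun s hs hs' => let ⟨w, hw, _⟩ := hs hs'; (hfd s hs' w hw).differentiableAt)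
  set g : ℝ → ℂ := fun s => deriv f s / f s with hg
  have hgpt : ∀ᵐ s : ℝ, s ∈ Ioc (0 : ℝ) 1 →
      (g s).re ≤ 0 ∧ |(g s).im| ≤ Real.tan α * -(g s).re := by
    have h1 : ∀ᵐ x : ℝ, x ≠ 1 := by simp [ae_iff, measure_singleton]
    filter_upwards [hang, h1] with s hs hs1 hs'
    have hs' : s ∈ Ioo (0 : ℝ) 1 := ⟨hs'.1, lt_of_le_of_ne hs'.2 hs1⟩
    obtain ⟨w, hw, hwa⟩ := hs hs'
    simp only [hg]
    rw [(hfd s hs' w hw).deriv, hfe s (Ioo_subset_Icc_self hs')]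
    refine re_div_nonpos_and_abs_im_div_le_of_angle_le hα₀ hα ?_
    rwa [neg_sub]
  refine ⟨∫ s in (0 : ℝ)..1, g s, ?_, ?_⟩
  · rw [← hfe 1 (by simp), ← hfe 0 (by simp)]
    exact hexp
  · have hre : (∫ s in (0 : ℝ)..1, g s).re = ∫ s in (0 : ℝ)..1, (g s).re :=
      (Complex.reCLM.intervalIntegral_comp_comm hgi).symm
    have him : (∫ s in (0 : ℝ)..1, g s).im = ∫ s in (0 : ℝ)..1, (g s).im :=
      (Complex.imCLM.intervalIntegral_comp_comm hgi).symm
    have hrei : IntervalIntegrable (fun s => (g s).re) volume 0 1 :=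
      ⟨Complex.reCLM.integrable_comp hgi.1, Complex.reCLM.integrable_comp hgi.2⟩
    rw [hre, him]
    constructor
    · rw [intervalIntegral.integral_of_le zero_le_one]
      refine setIntegral_nonpos_of_ae_restrict ?_
      refine (ae_restrict_iff' measurableSet_Ioc).2 ?_
      filter_upwards [hgpt] with s hs hs' using (hs hs').1
    · rw [← intervalIntegral.integral_neg, ← intervalIntegral.integral_const_mul]
      refine intervalIntegral.norm_integral_le_of_norm_le
        (f := fun s => (g s).im) (g := fun s => Real.tan α * -(g s).re) zero_le_one ?_
        (hrei.neg.const_mul _)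
      filter_upwards [hgpt] with s hs hs' using (hs hs').2

/-! ### Curves made of a right and a left spiral -/

/-- The distance to the root, relative to its value at `s = 0`, that decreases linearly from `1` at
`s = 0` to `κ` at `s = 1`. -/
noncomputable def spiralRadius (κ s : ℝ) : ℝ := 1 - s * (1 - κ)

/-- The point at distance `ρ` from the origin on the spiral in polar coordinates
`(e ^ (-u), t * (B + σ * u))`. For `ρ = 0` this is the origin, whatever the junk value
`log 0` is. -/
noncomputable def spiralBranch (t B σ ρ : ℝ) : ℂ :=
  ρ * Complex.exp ((t * (B - σ * Real.log ρ) : ℝ) * Complex.I)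

/-- The curve from `p` that follows the right spiral of `p` up to the spiral parameter `u₀` and the
left spiral of the point reached from then on, until the distance to `r` has shrunk by the factor
`κ`. It is parametrised by an affine function of this distance, which makes its speed constant and
the whole spiral (`κ = 0`) Lipschitz. The spiral parameter is `u = -log ρ`, and the polar angle is
`tan α * u` for `u ≤ u₀` and `tan α * (2 * u₀ - u)` for `u ≥ u₀`, so the minimum covers both
cases. -/
noncomputable def spiralCurve (r : ℂ) (α κ u₀ : ℝ) (p : ℂ) (s : ℝ) : ℂ :=
  r + (p - r) * (spiralRadius κ s * Complex.exp ((Real.tan α *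
    min (-Real.log (spiralRadius κ s)) (2 * u₀ + Real.log (spiralRadius κ s)) : ℝ) * Complex.I))

lemma spiralRadius_pos {κ s : ℝ} (hκ₀ : 0 ≤ κ) (hs : s ∈ Ico (0 : ℝ) 1) :
    0 < spiralRadius κ s := by
  unfold spiralRadius
  nlinarith [hs.1, hs.2]

lemma spiralRadius_strictAnti {κ : ℝ} (hκ : κ < 1) : StrictAnti (spiralRadius κ) := fun x y h => by
  unfold spiralRadius
  nlinarith

lemma continuous_spiralRadius (κ : ℝ) : Continuous (spiralRadius κ) := by
  unfold spiralRadius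
  fun_prop

lemma spiralCurve_eq_right {r : ℂ} {α κ u₀ s : ℝ} {p : ℂ}
    (h : -u₀ ≤ Real.log (spiralRadius κ s)) :
    spiralCurve r α κ u₀ p s =
      r + (p - r) * spiralBranch (Real.tan α) 0 1 (spiralRadius κ s) := by
  rw [spiralCurve, spiralBranch, min_eq_left (by linarith), zero_sub, one_mul]

lemma spiralCurve_eq_left {r : ℂ} {α κ u₀ s : ℝ} {p : ℂ}
    (h : Real.log (spiralRadius κ s) ≤ -u₀) :
    spiralCurve r α κ u₀ p s =
      r + (p - r) * spiralBranch (Real.tan α) (2 * u₀) (-1) (spiralRadius κ s) := by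
  rw [spiralCurve, spiralBranch, min_eq_right (by linarith), neg_one_mul, sub_neg_eq_add]

/-- Writing `1 ∓ tan α * I` in polar form exhibits both the speed factor `1 / cos α` and the angle
`α` of the spirals. -/
lemma one_sub_tan_mul_I {α σ : ℝ} (hcos : Real.cos α ≠ 0) (hσ : σ = 1 ∨ σ = -1) :
    (1 - (σ * Real.tan α : ℝ) * Complex.I : ℂ) =
      ((1 / Real.cos α : ℝ) : ℂ) * Complex.exp ((-(σ * α) : ℝ) * Complex.I) := by
  have hc : (Complex.cos α : ℂ) ≠ 0 := by exact_mod_cast hcos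
  rw [Complex.exp_mul_I, ← Complex.ofReal_cos, ← Complex.ofReal_sin, Real.tan_eq_sin_div_cos]
  rcases hσ with rfl | rfl <;> simp <;> field_simp
  ring

lemma hasDerivAt_spiralBranch {α B σ κ s : ℝ} (hcos : Real.cos α ≠ 0) (hσ : σ = 1 ∨ σ = -1)
    (hρ : spiralRadius κ s ≠ 0) :
    HasDerivAt (fun s => spiralBranch (Real.tan α) B σ (spiralRadius κ s))
      (-((1 - κ) / Real.cos α : ℝ) * Complex.exp ((Real.tan α *
        (B - σ * Real.log (spiralRadius κ s)) - σ * α : ℝ) * Complex.I)) s := by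
  have h1 : HasDerivAt (spiralRadius κ) (-(1 - κ)) s := by
    convert! ((hasDerivAt_id s).mul_const (1 - κ)).const_sub 1 using 1
    ring
  have h2 : HasDerivAt (fun s => Real.tan α * (B - σ * Real.log (spiralRadius κ s)))
      (Real.tan α * -(σ * (-(1 - κ) / spiralRadius κ s))) s :=
    (((h1.log hρ).const_mul σ).const_sub B).const_mul _
  have h3 := h1.ofReal_comp.mul (h2.ofReal_comp.mul_const Complex.I).cexp
  unfold spiralBranch
  convert! h3 using 1
  have hsplit : (((Real.tan α * (B - σ * Real.log (spiralRadius κ s)) - σ * α : ℝ) : ℂ) * Complex.I)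
      = ((Real.tan α * (B - σ * Real.log (spiralRadius κ s)) : ℝ) : ℂ) * Complex.I
        + ((-(σ * α) : ℝ) : ℂ) * Complex.I := by push_cast; ring
  rw [hsplit, Complex.exp_add]
  have hk := one_sub_tan_mul_I hcos hσ
  have hρ' : (spiralRadius κ s : ℂ) ≠ 0 := by exact_mod_cast hρ
  generalize Complex.exp
    (((Real.tan α * (B - σ * Real.log (spiralRadius κ s)) : ℝ) : ℂ) * Complex.I) = e
  have hE : ((1 - κ) / Real.cos α : ℝ) = (1 - κ) * (1 / Real.cos α) := by ring
  rw [hE]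
  generalize Complex.exp (((-(σ * α) : ℝ) : ℂ) * Complex.I) = e' at hk ⊢
  rw [Complex.ofReal_mul]
  generalize ((1 / Real.cos α : ℝ) : ℂ) = k at hk ⊢
  push_cast at hk ⊢
  field_simp
  linear_combination (1 - (κ : ℂ)) * e * hk

/-- The spirals meet the direction towards the root at the constant angle `α`. The second vector is
the tangent vector computed in `hasDerivAt_spiralBranch`. -/
lemma angle_spiralBranch {α B σ ρ κ : ℝ} {a : ℂ} (hα₀ : 0 ≤ α) (hα : α < Real.pi / 2)
    (hσ : σ = 1 ∨ σ = -1) (ha : a ≠ 0) (hρ : 0 < ρ) (hκ : κ < 1) :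
    InnerProductGeometry.angle (-(a * spiralBranch (Real.tan α) B σ ρ))
      (a * (-((1 - κ) / Real.cos α : ℝ) * Complex.exp ((Real.tan α *
        (B - σ * Real.log ρ) - σ * α : ℝ) * Complex.I))) = α := by
  have hcos : 0 < Real.cos α := Real.cos_pos_of_mem_Ioo ⟨by linarith [Real.pi_pos], hα⟩
  have hk : 0 < (1 - κ) / Real.cos α := div_pos (by linarith) hcos
  have e1 : -(a * spiralBranch (Real.tan α) B σ ρ) =
      ρ • (-a * Complex.exp ((Real.tan α * (B - σ * Real.log ρ) : ℝ) * Complex.I)) := by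
    rw [spiralBranch, Complex.real_smul]; ring
  have e2 : (a * (-((1 - κ) / Real.cos α : ℝ) * Complex.exp ((Real.tan α *
        (B - σ * Real.log ρ) - σ * α : ℝ) * Complex.I))) =
      ((1 - κ) / Real.cos α) • (-a * Complex.exp
        ((Real.tan α * (B - σ * Real.log ρ) - σ * α : ℝ) * Complex.I)) := by
    rw [Complex.real_smul]; ring
  rw [e1, e2, InnerProductGeometry.angle_smul_left_of_pos _ _ hρ,
    InnerProductGeometry.angle_smul_right_of_pos _ _ hk, Complex.angle_mul_left (neg_ne_zero.2 ha),
    Complex.angle_exp_exp, sub_sub_cancel]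
  rw [(toIocMod_eq_self _).2]
  · rcases hσ with rfl | rfl <;> simp [abs_of_nonneg hα₀]
  · rcases hσ with rfl | rfl <;> constructor <;> linarith [Real.pi_pos]

lemma norm_mul_neg_mul_exp_ofReal_mul_I {a : ℂ} {k x : ℝ} (hk : 0 ≤ k) :
    ‖a * (-(k : ℂ) * Complex.exp ((x : ℝ) * Complex.I))‖ = ‖a‖ * k := by
  rw [norm_mul, norm_mul, Complex.norm_exp_ofReal_mul_I, norm_neg, Complex.norm_real,
    Real.norm_of_nonneg hk, mul_one]

lemma continuousOn_spiralCurve (r : ℂ) (α κ u₀ : ℝ) (p : ℂ) :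
    ContinuousOn (spiralCurve r α κ u₀ p) (Icc 0 1) := by
  intro s hs
  refine ContinuousAt.continuousWithinAt ?_
  have hρ := (continuous_spiralRadius κ).continuousAt (x := s)
  refine continuousAt_const.add (continuousAt_const.mul ?_)
  -- At the root the polar angle is undefined, but the modulus tends to zero.
  by_cases h0 : spiralRadius κ s = 0
  · rw [ContinuousAt, h0, Complex.ofReal_zero, zero_mul, tendsto_zero_iff_norm_tendsto_zero]
    have : Filter.Tendsto (fun x => |spiralRadius κ x|) (nhds s) (nhds 0) := by
      simpa [h0] using hρ.abs.tendsto
    refine this.congr fun x => ?_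
    rw [norm_mul, Complex.norm_exp_ofReal_mul_I, mul_one, Complex.norm_real, Real.norm_eq_abs]
  · have hl : ContinuousAt (fun x => Real.log (spiralRadius κ x)) s := hρ.log h0
    refine (Complex.continuous_ofReal.continuousAt.comp hρ).mul ?_
    refine (ContinuousAt.mul ?_ continuousAt_const).cexp
    exact Complex.continuous_ofReal.continuousAt.comp
      (continuousAt_const.mul (hl.neg.min (continuousAt_const.add hl)))

lemma isSpiralSegment_of_eq_spiralBranch {r p : ℂ} {α κ B σ a b : ℝ} {c : ℝ → ℂ} (hκ₀ : 0 ≤ κ)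
    (hκ : κ < 1) (hp : p ≠ r) (hσ : σ = 1 ∨ σ = -1) (ha : 0 ≤ a) (hab : a < b) (hb : b ≤ 1)
    (hc : ContinuousOn c (Icc a b))
    (h : ∀ s ∈ Ico a b, c s = r + (p - r) * spiralBranch (Real.tan α) B σ (spiralRadius κ s)) :
    IsSpiralSegment r α c a b := by
  have hpos : ∀ s ∈ Ico a b, 0 < spiralRadius κ s := fun s hs =>
    spiralRadius_pos hκ₀ ⟨ha.trans hs.1, hs.2.trans_le hb⟩
  have haa : a ∈ Ico a b := ⟨le_rfl, hab⟩
  refine ⟨hab, ?_, hc, σ, hσ,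
    fun s => Real.log (spiralRadius κ a) - Real.log (spiralRadius κ s), by simp, ?_, ?_, ?_⟩
  · rw [h a haa, ← sub_ne_zero, add_sub_cancel_left, spiralBranch]
    exact mul_ne_zero (sub_ne_zero.2 hp)
      (mul_ne_zero (Complex.ofReal_ne_zero.2 (hpos a haa).ne') (Complex.exp_ne_zero _))
  · intro x hx y hy hxy
    exact sub_lt_sub_left (Real.log_lt_log (hpos y hy) (spiralRadius_strictAnti hκ hxy)) _
  · exact continuousOn_const.sub
      ((continuous_spiralRadius κ).continuousOn.log fun s hs => (hpos s hs).ne')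
  · intro s hs
    have key : ∀ x ∈ Ico a b, spiralBranch (Real.tan α) B σ (spiralRadius κ x) =
        Complex.exp (Real.log (spiralRadius κ x) +
          (Real.tan α * (B - σ * Real.log (spiralRadius κ x)) : ℝ) * Complex.I) := fun x hx => by
      rw [spiralBranch, Complex.exp_add, ← Complex.ofReal_exp, Real.exp_log (hpos x hx)]
    rw [logSpiral, h s hs, h a haa, add_sub_cancel_left, mul_assoc, key s hs, key a haa,
      ← Complex.exp_add]
    congr 3
    push_cast
    ring

/-- The Lipschitz constant is the speed of the curve, so it bounds the length by `1 / cos α` times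
the decrease of the distance to the root. -/
theorem lipschitzOnWith_spiralCurve {r p : ℂ} {α κ u₀ : ℝ} (hα₀ : 0 ≤ α) (hα : α < Real.pi / 2)
    (hκ₀ : 0 ≤ κ) (hκ : κ < 1) :
    LipschitzOnWith (‖p - r‖ * ((1 - κ) / Real.cos α)).toNNReal
      (spiralCurve r α κ u₀ p) (Icc 0 1) := by
  have hcos : 0 < Real.cos α := Real.cos_pos_of_mem_Ioo ⟨by linarith [Real.pi_pos], hα⟩
  have hk : 0 ≤ (1 - κ) / Real.cos α := div_nonneg (by linarith) hcos.le
  have hcont := continuousOn_spiralCurve r α κ u₀ p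
  -- One-sided derivatives suffice, and they exist also where the two spirals meet.
  have hder : ∀ s ∈ Ico (0 : ℝ) 1, ∃ d : ℂ, HasDerivWithinAt (spiralCurve r α κ u₀ p) d (Ici s) s ∧
      ‖d‖ ≤ ‖p - r‖ * ((1 - κ) / Real.cos α) := fun s hs => by
    have hρ := spiralRadius_pos hκ₀ hs
    rcases lt_or_ge (-u₀) (Real.log (spiralRadius κ s)) with h | h
    · refine ⟨_, ((((hasDerivAt_spiralBranch (B := 0) hcos.ne' (Or.inl rfl) hρ.ne').const_mul
        (p - r)).const_add r).congr_of_eventuallyEq ?_).hasDerivWithinAt,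
        (norm_mul_neg_mul_exp_ofReal_mul_I hk).le⟩
      have hl := ((continuous_spiralRadius κ).continuousAt (x := s)).log hρ.ne'
      filter_upwards [hl.eventually (lt_mem_nhds h)] with x hx
      exact spiralCurve_eq_right hx.le
    · refine ⟨_, ((((hasDerivAt_spiralBranch (B := 2 * u₀) hcos.ne' (Or.inr rfl) hρ.ne').const_mul
        (p - r)).const_add r).hasDerivWithinAt.congr_of_eventuallyEq ?_ (spiralCurve_eq_left h)),
        (norm_mul_neg_mul_exp_ofReal_mul_I hk).le⟩
      filter_upwards [self_mem_nhdsWithin,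
        mem_nhdsWithin_of_mem_nhds (Iio_mem_nhds hs.2)] with x hx hx1
      refine spiralCurve_eq_left (le_trans ?_ h)
      exact Real.log_le_log (spiralRadius_pos hκ₀ ⟨hs.1.trans hx, hx1⟩)
        ((spiralRadius_strictAnti hκ).antitone hx)
  choose! d hd hdn using hder
  refine LipschitzOnWith.of_dist_le_mul fun x hx y hy => ?_
  rw [Real.coe_toNNReal _ (mul_nonneg (norm_nonneg _) hk)]
  wlog hxy : x ≤ y generalizing x y
  · rw [dist_comm, dist_comm x]
    exact this y hy x hx (le_of_not_ge hxy)
  rw [dist_comm, dist_comm x, dist_eq_norm, Real.dist_eq, abs_of_nonneg (sub_nonneg.2 hxy)]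
  exact norm_image_sub_le_of_norm_deriv_right_le_segment
    (hcont.mono (Icc_subset_Icc hx.1 hy.2))
    (fun s hs => hd s ⟨hx.1.trans hs.1, hs.2.trans_le hy.2⟩)
    (fun s hs => hdn s ⟨hx.1.trans hs.1, hs.2.trans_le hy.2⟩) y ⟨hxy, le_rfl⟩

theorem isAngleRestricted_spiralCurve {r p : ℂ} {α κ : ℝ} (u₀ : ℝ) (hα₀ : 0 ≤ α)
    (hα : α < Real.pi / 2) (hp : p ≠ r) (hκ₀ : 0 ≤ κ) (hκ : κ < 1) :
    IsAngleRestricted r α (spiralCurve r α κ u₀ p) := by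
  have hcos : 0 < Real.cos α := Real.cos_pos_of_mem_Ioo ⟨by linarith [Real.pi_pos], hα⟩
  refine ⟨⟨_, lipschitzOnWith_spiralCurve hα₀ hα hκ₀ hκ⟩, ?_⟩
  -- The excluded parameter is the one where the two spirals meet.
  have hne : ∀ᵐ s : ℝ, s ≠ (1 - Real.exp (-u₀)) / (1 - κ) := by simp [ae_iff, measure_singleton]
  filter_upwards [hne] with s hs' hs
  have hρ := spiralRadius_pos hκ₀ (Ioo_subset_Ico_self hs)
  have hl := ((continuous_spiralRadius κ).continuousAt (x := s)).log hρ.ne'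
  have hκ1 : (1 - κ) ≠ 0 := by linarith
  have hne : Real.log (spiralRadius κ s) ≠ -u₀ := fun h => hs' <| by
    rw [← h, Real.exp_log hρ, spiralRadius]
    field_simp
    ring
  have hang : ∀ B σ : ℝ, (σ = 1 ∨ σ = -1) → (∀ᶠ x in nhds s, spiralCurve r α κ u₀ p x =
      r + (p - r) * spiralBranch (Real.tan α) B σ (spiralRadius κ x)) → ∃ w : ℂ,
      HasDerivAt (spiralCurve r α κ u₀ p) w s ∧
        InnerProductGeometry.angle (r - spiralCurve r α κ u₀ p s) w ≤ α := fun B σ hσ h => by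
    refine ⟨_, (((hasDerivAt_spiralBranch (B := B) hcos.ne' hσ hρ.ne').const_mul
        (p - r)).const_add r).congr_of_eventuallyEq h, ?_⟩
    rw [h.self_of_nhds, sub_add_cancel_left]
    exact (angle_spiralBranch hα₀ hα hσ (sub_ne_zero.2 hp) hρ hκ).le
  rcases lt_or_gt_of_ne hne with h | h
  · refine hang (2 * u₀) _ (Or.inr rfl) ?_
    filter_upwards [hl.eventually (gt_mem_nhds h)] with x hx
    exact spiralCurve_eq_left hx.le
  · refine hang 0 _ (Or.inl rfl) ?_
    filter_upwards [hl.eventually (lt_mem_nhds h)] with x hx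
    exact spiralCurve_eq_right hx.le

theorem isPiecewiseSpiral_spiralCurve {r p : ℂ} {α κ u₀ : ℝ}
    (hp : p ≠ r) (hκ₀ : 0 ≤ κ) (hκ : κ < 1) :
    IsPiecewiseSpiral r α (spiralCurve r α κ u₀ p) := by
  have hcont := continuousOn_spiralCurve r α κ u₀ p
  -- At `s₀` the curve changes from the right to the left spiral; if `s₀` is not in `(0, 1)`, there
  -- is only one segment.
  set s₀ : ℝ := (1 - Real.exp (-u₀)) / (1 - κ) with hs₀
  have hκ1 : 0 < 1 - κ := by linarith
  have hle : ∀ s ∈ Ico (0 : ℝ) 1, s ≤ s₀ → -u₀ ≤ Real.log (spiralRadius κ s) := fun s hs h => by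
    rw [Real.le_log_iff_exp_le (spiralRadius_pos hκ₀ hs), spiralRadius]
    rw [hs₀, le_div_iff₀ hκ1] at h
    linarith
  have hge : ∀ s ∈ Ico (0 : ℝ) 1, s₀ ≤ s → Real.log (spiralRadius κ s) ≤ -u₀ := fun s hs h => by
    rw [Real.log_le_iff_le_exp (spiralRadius_pos hκ₀ hs), spiralRadius]
    rw [hs₀, div_le_iff₀ hκ1] at h
    linarith
  have hright : ∀ b, 0 < b → b ≤ s₀ → b ≤ 1 →
      IsSpiralSegment r α (spiralCurve r α κ u₀ p) 0 b := fun b hb hbs hb1 =>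
    isSpiralSegment_of_eq_spiralBranch hκ₀ hκ hp (Or.inl rfl) le_rfl hb hb1
      (hcont.mono (Icc_subset_Icc le_rfl hb1)) fun s hs =>
        spiralCurve_eq_right (hle s ⟨hs.1, hs.2.trans_le hb1⟩ (hs.2.le.trans hbs))
  have hleft : ∀ a, 0 ≤ a → s₀ ≤ a → a < 1 →
      IsSpiralSegment r α (spiralCurve r α κ u₀ p) a 1 := fun a ha has ha1 =>
    isSpiralSegment_of_eq_spiralBranch hκ₀ hκ hp (Or.inr rfl) ha ha1 le_rfl
      (hcont.mono (Icc_subset_Icc ha le_rfl)) fun s hs =>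
        spiralCurve_eq_left (hge s ⟨ha.trans hs.1, hs.2⟩ (has.trans hs.1))
  rcases le_or_gt s₀ 0 with h | h
  · exact ⟨1, fun i => i, by simp, by simp, fun i hi => by
      obtain rfl : i = 0 := by lia
      simpa using hleft 0 le_rfl h zero_lt_one⟩
  rcases le_or_gt 1 s₀ with h' | h'
  · exact ⟨1, fun i => i, by simp, by simp, fun i hi => by
      obtain rfl : i = 0 := by lia
      simpa using hright 1 zero_lt_one h' le_rfl⟩
  · refine ⟨2, fun i => if i = 0 then 0 else if i = 1 then s₀ else 1, by simp, by simp,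
      fun i hi => ?_⟩
    obtain rfl | rfl : i = 0 ∨ i = 1 := by lia
    · simpa using hright s₀ h le_rfl h'.le
    · simpa using hleft s₀ h.le le_rfl h'

theorem spiralCurve_zero (r : ℂ) (α κ : ℝ) {u₀ : ℝ} (hu₀ : 0 ≤ u₀) (p : ℂ) :
    spiralCurve r α κ u₀ p 0 = p := by
  simp [spiralCurve, spiralRadius, hu₀]

theorem spiralCurve_one (r : ℂ) (α u₀ : ℝ) {κ : ℝ} (p : ℂ) (h : κ = 0 ∨ u₀ ≤ -Real.log κ) :
    spiralCurve r α κ u₀ p 1 =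
      r + (p - r) * (κ * Complex.exp ((Real.tan α * (2 * u₀ + Real.log κ) : ℝ) * Complex.I)) := by
  have hρ : spiralRadius κ 1 = κ := by simp [spiralRadius]
  rw [spiralCurve, hρ]
  rcases h with rfl | h
  · simp
  · rw [min_eq_right (by linarith)]

/-! ### Replacing arcs by spiral segments -/

/-- An angle-restricted curve can be replaced by at most two spiral segments with the same end
points, at the cost of a factor `1 / cos α` in length: both spirals have length `1 / cos α` times
the decrease of the distance to the root, and this decrease is a lower bound for the length of any
curve. -/
theorem IsAngleRestricted.exists_spiral_arc {r : ℂ} {α : ℝ} {c : ℝ → ℂ} (hα₀ : 0 ≤ α)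
    (hα : α < Real.pi / 2) (hc : IsAngleRestricted r α c) (h0 : c 0 ≠ r) (h01 : c 0 ≠ c 1) :
    ∃ d : ℝ → ℂ, ContinuousOn d (Icc 0 1) ∧ d 0 = c 0 ∧ d 1 = c 1 ∧ IsAngleRestricted r α d ∧
      IsPiecewiseSpiral r α d ∧
      eVariationOn d (Icc 0 1) ≤
        ENNReal.ofReal (1 / Real.cos α) * eVariationOn c (Icc 0 1) := by
  have hcos : 0 < Real.cos α := Real.cos_pos_of_mem_Ioo ⟨by linarith [Real.pi_pos], hα⟩
  obtain ⟨κ, u₀, hκ₀, hκ, hu₀, hone, hnorm⟩ : ∃ κ u₀ : ℝ, 0 ≤ κ ∧ κ < 1 ∧ 0 ≤ u₀ ∧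
      spiralCurve r α κ u₀ (c 0) 1 = c 1 ∧ ‖c 1 - r‖ = ‖c 0 - r‖ * κ := by
    by_cases h1 : c 1 = r
    · -- Any spiral reaches the root; `u₀ = 0` selects the left one.
      exact ⟨0, 0, le_rfl, zero_lt_one, le_rfl,
        by rw [spiralCurve_one _ _ _ _ (Or.inl rfl)]; simp [h1], by simp [h1]⟩
    · obtain ⟨w, hw, hre, him⟩ := hc.exists_exp hα₀ hα h1
      have hre' : w.re < 0 := by
        refine lt_of_le_of_ne hre fun h => h01 ?_
        rw [h, neg_zero, mul_zero, abs_nonpos_iff] at him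
        have : w = 0 := Complex.ext h him
        rw [this, Complex.exp_zero, mul_one] at hw
        exact (sub_left_injective hw).symm
      have ht : 0 ≤ Real.tan α := Real.tan_nonneg_of_nonneg_of_le_pi_div_two hα₀ hα.le
      obtain ⟨h3, h4⟩ := abs_le.1 him
      -- The right spiral up to `u₀` and the left spiral up to `-w.re` turn by
      -- `tan α * (u₀ - (-w.re - u₀))`, which has to equal `w.im`.
      obtain ⟨u₀, hu₀, hu₁, hu⟩ : ∃ u₀ : ℝ, 0 ≤ u₀ ∧ u₀ ≤ -w.re ∧
          Real.tan α * (2 * u₀ + w.re) = w.im := by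
        rcases ht.eq_or_lt with ht | ht
        · rw [← ht] at h3 h4 ⊢
          exact ⟨0, le_rfl, by linarith, by linarith⟩
        · refine ⟨(w.im / Real.tan α - w.re) / 2, ?_, ?_, by field_simp; ring⟩
          · have : w.re ≤ w.im / Real.tan α := by rw [le_div_iff₀ ht]; linarith
            linarith
          · have : w.im / Real.tan α ≤ -w.re := by rw [div_le_iff₀ ht]; linarith
            linarith
      refine ⟨Real.exp w.re, u₀, (Real.exp_pos _).le, Real.exp_lt_one_iff.2 hre', hu₀, ?_, ?_⟩
      · rw [spiralCurve_one _ _ _ _ (Or.inr (by rwa [Real.log_exp])), Real.log_exp, hu,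
          Complex.ofReal_exp, ← Complex.exp_add, Complex.re_add_im, ← hw, add_sub_cancel]
      · rw [hw, norm_mul, Complex.norm_exp]
  refine ⟨spiralCurve r α κ u₀ (c 0), continuousOn_spiralCurve _ _ _ _ _,
    spiralCurve_zero _ _ _ hu₀ _, hone, isAngleRestricted_spiralCurve u₀ hα₀ hα h0 hκ₀ hκ,
    isPiecewiseSpiral_spiralCurve h0 hκ₀ hκ, ?_⟩
  calc eVariationOn (spiralCurve r α κ u₀ (c 0)) (Icc 0 1)
      ≤ (‖c 0 - r‖ * ((1 - κ) / Real.cos α)).toNNReal * eVariationOn id (Icc (0 : ℝ) 1) :=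
        (lipschitzOnWith_spiralCurve hα₀ hα hκ₀ hκ).comp_eVariationOn_le (mapsTo_id _)
    _ = ENNReal.ofReal (1 / Real.cos α) * ENNReal.ofReal (‖c 0 - r‖ - ‖c 1 - r‖) := by
        rw [eVariationOn_id_Icc, sub_zero, ENNReal.ofReal_one, mul_one, hnorm,
          ← ENNReal.ofReal_mul (by positivity)]
        change ENNReal.ofReal _ = _
        congr 1
        field_simp
    _ ≤ ENNReal.ofReal (1 / Real.cos α) * edist (c 0) (c 1) := by
        gcongr
        rw [edist_dist, dist_eq_norm]
        refine ENNReal.ofReal_le_ofReal ((norm_sub_norm_le _ _).trans ?_)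
        rw [sub_sub_sub_cancel_right]
    _ ≤ _ := by
        gcongr
        exact eVariationOn.edist_le c (by simp) (by simp)

/-- A node that is its own parent would never reach the root. -/
lemma SteinerArborescence.parent_ne_self {r : ℂ} {n : ℕ} {t : Fin n → ℂ}
    (T : SteinerArborescence r t) {v : ℂ} (hv : v ∈ T.nodes) (hr : v ≠ r) : T.parent v ≠ v :=
  fun h => by
    obtain ⟨k, hk⟩ := T.reaches_root v hv
    exact hr ((Function.iterate_fixed h k).symm.trans hk)

/-- Replacing every arc by spiral segments keeps the nodes and the parents. -/
theorem SteinerArborescence.IsFluxTree.exists_isSpiralTree {r : ℂ} {n : ℕ} {t : Fin n → ℂ}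
    {α : ℝ} {T : SteinerArborescence r t} (hα₀ : 0 ≤ α) (hα : α < Real.pi / 2)
    (hT : T.IsFluxTree α) :
    ∃ S : SteinerArborescence r t, S.IsSpiralTree α ∧
      S.length ≤ ENNReal.ofReal (1 / Real.cos α) * T.length := by
  have h : ∀ v ∈ T.nodes, v ≠ r → ∃ d : ℝ → ℂ, ContinuousOn d (Icc 0 1) ∧ d 0 = v ∧
      d 1 = T.parent v ∧ IsAngleRestricted r α d ∧ IsPiecewiseSpiral r α d ∧
      eVariationOn d (Icc 0 1) ≤
        ENNReal.ofReal (1 / Real.cos α) * eVariationOn (T.arc v) (Icc 0 1) := fun v hv hr => by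
    have e0 := T.arc_zero v hv hr
    have e1 := T.arc_one v hv hr
    have := (hT v hv hr).exists_spiral_arc hα₀ hα (by rwa [e0])
      (by rw [e0, e1]; exact (T.parent_ne_self hv hr).symm)
    rwa [e0, e1] at this
  choose! d hcont hzero hone hang hspiral hlen using h
  refine ⟨{ T with
    arc := d
    arc_continuousOn := hcont
    arc_zero := hzero
    arc_one := hone }, ⟨hang, hspiral⟩, ?_⟩
  rw [SteinerArborescence.length, SteinerArborescence.length, Finset.mul_sum]
  exact Finset.sum_le_sum fun v hv =>
    hlen v (Finset.mem_of_mem_erase hv) (Finset.ne_of_mem_erase hv)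

theorem mainTheorem1 {n : ℕ} (r : ℂ) (t : Fin n → ℂ) (α : ℝ) (hα₀ : 0 ≤ α) (hα : α < Real.pi / 2) :
    (∀ T' T : SteinerArborescence r t, T'.IsOptimalSpiralTree α → T.IsOptimalFluxTree α →
      T'.length ≤ ENNReal.ofReal (1 / Real.cos α) * T.length) ∧
    (⨅ (T' : SteinerArborescence r t) (_ : T'.IsSpiralTree α), T'.length) ≤
      ENNReal.ofReal (1 / Real.cos α) *
        ⨅ (T : SteinerArborescence r t) (_ : T.IsFluxTree α), T.length := by
  have hcos : 0 < Real.cos α := Real.cos_pos_of_mem_Ioo ⟨by linarith [Real.pi_pos], hα⟩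
  have hne : ENNReal.ofReal (1 / Real.cos α) ≠ 0 := by
    rw [Ne, ENNReal.ofReal_eq_zero, not_le]
    positivity
  refine ⟨fun T' T hT' hT => ?_, ?_⟩
  · obtain ⟨S, hS, hle⟩ := hT.1.exists_isSpiralTree hα₀ hα
    exact (hT'.2 S hS).trans hle
  · simp only [ENNReal.mul_iInf_of_ne hne ENNReal.ofReal_ne_top]
    refine le_iInf₂ fun T hT => ?_
    obtain ⟨S, hS, hle⟩ := hT.exists_isSpiralTree hα₀ hα
    exact (iInf₂_le S hS).trans hle
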